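/- **Setting.** Let $G=(V,E)$ be a directed graph on $n$ nodes, and let $N_i^+=\{j : (i,j)\in E\}\cup\{i\}$. Node $i$ can send messages exactly to the nodes of $N_i^+$. The system is asynchronous: nodes start at arbitrary times, and message delays are finite but unbounded. Every message sent is delivered exactly once, if its receiver does not crash; messages need not arrive in the order in which they were sent. At most $f$ nodes are faulty. A faulty node may stop at any time, also in the middle of a step, so that only some of the messages of that step are sent. Node $i$ has an input $x_i\in\mathbb R$. For $F\subseteq V$, let $G_F$ be the graph obtained from $G$ by deleting the nodes of $F$ and all links incident on them, and let $\mathrm{reach}_i(F)$ be the set of nodes that have a (possibly trivial) directed path to $i$ in $G_F$. For disjoint $A,B\subseteq V$, we say that $A$ *propagates* to $B$ if $B\neq\emptyset$ and $|\{i\in A : N_i^+\cap B\ne\emptyset\}|\ge f+1$. The graph $G$ satisfies the *propagation condition* if for every partition $L,C,R$ of $V$ with $L,R\neq\emptyset$ ($C$ may be empty), $L\cup C$ propagates to $R$ or $C\cup R$ propagates to $L$. **Algorithm WA** (with parameter $p_{end}$). Node $i$ sets $v_i[0]=x_i$ and goes through phases $p=1,\dots,p_{end}$. On entering phase $p$ it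 puts its own value $v_i[p-1]$ into $R_i[p]$ and itself into $heard_i[p]$, and sends $(v_i[p-1],i,p)$ to all nodes of $N_i^+$. Whenever it receives a message $(h,j,p)$ for the first time, whatever phase it is in itself, it adds $h$ to $R_i[p]$ and $j$ to $heard_i[p]$ and forwards $(h,j,p)$ to all nodes of $N_i^+$. If $p$ is its current phase and there is then a set $F_i\subseteq V\setminus\{i\}$ with $|F_i|\le f$ and $\mathrm{reach}_i(F_i)\subseteq heard_i[p]$, it sets $v_i[p]$ to the average of $R_i[p]$ and enters phase $p+1$. After phase $p_{end}$ it outputs $v_i[p_{end}]$ (and goes on forwarding messages). Here $R_i[p]$ may be read either as a set of values, or as a family with one value for each node in $heard_i[p]$; the theorem holds for both readings. **Theorem 6.** Let $n,f\in\mathbb N$, $m,M\in\mathbb R$ and $\epsilon>0$. There is a $P$, depending only on $n,f,m,M,\epsilon$, such that for all $p_{end}\ge P$, for every graph $G$ on $n$ nodes that satisfies the propagation condition and for all inputs in $[m,M]$, every execution of Algorithm WA with at most $f$ faulty nodes has the following properties. - *$\epsilon$-agreement*: the outputs of any two fault-free nodes differ by at most $\epsilon$. - *Validity*: the output of any fault-free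 node lies in the convex hull of all the inputs. - *Termination*: every fault-free node outputs a value after finitely many steps. -/

import Mathlib

universe u

namespace WaitAverage

/-! ### The network -/

section Graph

variable {V : Type u}

/-- The closed out-neighbourhood `N⁺(i)` of `i`: the nodes that can receive messages from `i`.
It always contains `i` itself (so loops of `G` play no role). -/
noncomputable def outNbrs [Fintype V] (G : Digraph V) (i : V) : Finset V :=
  open scoped Classical in Finset.univ.filter fun j => j = i ∨ G.Adj i j

/-- `A` propagates to `B`: `B` is not empty, and at least `f + 1` nodes of `A` have outgoing links
to some node of `B`. -/
def Propagates [Fintype V] (G : Digraph V) (f : ℕ) (A B : Finset V) : Prop :=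
  B.Nonempty ∧
    f + 1 ≤ Set.ncard {i : V | i ∈ A ∧ ∃ j ∈ B, j ∈ outNbrs G i}

/-- For every partition `L, C, R` of the nodes (where `C` may be empty) with `L` and `R` not empty,
`L ∪ C` propagates to `R` or `C ∪ R` propagates to `L`. -/
def PropagationCondition [Fintype V] (G : Digraph V) (f : ℕ) : Prop :=
  open scoped Classical in
  ∀ L C R : Finset V, Disjoint L C → Disjoint L R → Disjoint C R →
    L ∪ C ∪ R = Finset.univ → L.Nonempty → R.Nonempty →
    Propagates G f (L ∪ C) R ∨ Propagates G f (C ∪ R) L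

/-- The links of the reduced graph `G_F`, whose nodes are the nodes outside `F`. -/
def reduced (G : Digraph V) (F : Finset V) : Digraph V where
  Adj i j := G.Adj i j ∧ i ∉ F ∧ j ∉ F

/-- The nodes of `G_F` that have a (possibly trivial) directed path to `i` in `G_F`. -/
def reach (G : Digraph V) (F : Finset V) (i : V) : Set V :=
  {j | j ∉ F ∧ Relation.ReflTransGen (reduced G F).Adj j i}

end Graph

/-! ### The algorithm -/

/-- A message `(h, j, p)`: the value `h` that node `j` holds on entering phase `p`. -/
structure Msg (V : Type u) where
  value : ℝ
  sender : V
  phase : ℕ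

/-- Two ways to read "the average of all the values received": over the set of the distinct values,
or with one summand for every node heard from. -/
inductive Averaging where
  | distinctValues
  | perNode

/-- The local memory of a node. -/
structure LocalState (V : Type u) where
  /-- The current phase; `0` before the node starts, `p_end + 1` after its last phase. -/
  phase : ℕ
  /-- The current value: it is `v[p - 1]` during phase `p`. -/
  val : ℝ
  /-- All messages received so far (of any phase). -/
  received : Set (Msg V)
  /-- For every phase `p`, the pairs `(j, h)` collected for phase `p`: node `j`, value `h`. -/
  got : ℕ → Finset (V × ℝ)
  /-- The output, once the node has decided. -/
  out : Option ℝ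

section Algorithm

variable {V : Type u}

/-- `heard[p]`: the nodes whose phase `p` values are available. -/
def LocalState.heard (s : LocalState V) (p : ℕ) : Set V :=
  {j | ∃ h, (j, h) ∈ s.got p}

/-- `R[p]`: the set of the values collected for phase `p`. -/
noncomputable def LocalState.R (s : LocalState V) (p : ℕ) : Finset ℝ :=
  (s.got p).image Prod.snd

/-- The average of the values collected for phase `p`. -/
noncomputable def LocalState.average (s : LocalState V) (mode : Averaging) (p : ℕ) : ℝ :=
  match mode with
  | .distinctValues => (∑ v ∈ s.R p, v) / (s.R p).card
  | .perNode => (∑ x ∈ s.got p, x.2) / (s.got p).card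

/-- Condition WAIT for node `i` in phase `p`. -/
def Wait (G : Digraph V) (f : ℕ) (i : V) (s : LocalState V) (p : ℕ) : Prop :=
  ∃ F : Finset V, i ∉ F ∧ F.card ≤ f ∧ reach G F i ⊆ s.heard p

/-- Add the pair `(j, h)` to the data of phase `p`. -/
noncomputable def LocalState.record (s : LocalState V) (p : ℕ) (j : V) (h : ℝ) : LocalState V :=
  open scoped Classical in
  { s with got := Function.update s.got p (insert (j, h) (s.got p)) }

/-- Store a newly received message. -/
noncomputable def LocalState.store (s : LocalState V) (m : Msg V) : LocalState V :=
  { s.record m.phase m.sender m.value with received := insert m s.received }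

/-- Replace the current value by the average for the current phase. -/
noncomputable def LocalState.doAverage (s : LocalState V) (mode : Averaging) : LocalState V :=
  { s with val := s.average mode s.phase }

/-- The state of a node that has not started yet. -/
def LocalState.init (x : ℝ) : LocalState V where
  phase := 0
  val := x
  received := ∅
  got := fun _ => ∅
  out := none

/-- Node `i` enters phase `p`: its new local state and the messages that it sends to all its
out-neighbours. If all `pEnd` phases are over it outputs its value instead.
Phase `p` messages that arrived early have been kept, and count as received in phase `p`. -/
noncomputable def enter (pEnd : ℕ) (i : V) (p : ℕ) (s : LocalState V) :
    LocalState V × Multiset (Msg V) :=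
  if p ≤ pEnd then
    ({ s.record p i s.val with phase := p }, {⟨s.val, i, p⟩})
  else
    ({ s with phase := p, out := some s.val }, 0)

/-- Node `i` receives the message `m`: its new local state and the messages that it sends to all
its out-neighbours. A message that it has already received is ignored. A message (of any phase)
received for the first time is recorded and forwarded; if it belongs to the current phase and
Condition WAIT holds, then the node averages and enters the next phase. -/
noncomputable def receive (G : Digraph V) (f pEnd : ℕ) (mode : Averaging) (i : V) (m : Msg V)
    (s : LocalState V) : LocalState V × Multiset (Msg V) :=
  open scoped Classical in
  if m ∈ s.received then (s, 0)
  else if m.phase = s.phase ∧ Wait G f i (s.store m) s.phase then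
    ((enter pEnd i (s.phase + 1) ((s.store m).doAverage mode)).1,
      m ::ₘ (enter pEnd i (s.phase + 1) ((s.store m).doAverage mode)).2)
  else (s.store m, {m})

end Algorithm

/-! ### Asynchronous executions with crash faults -/

/-- A message in transit on the link from `src` to `dst`. -/
structure Packet (V : Type u) where
  src : V
  dst : V
  msg : Msg V

/-- A global configuration: local states, messages in transit, nodes that have crashed. -/
structure Config (V : Type u) where
  loc : V → LocalState V
  transit : Multiset (Packet V)
  crashed : Set V

/-- What may happen in one step. -/
inductive Event (V : Type u) where
  | idle
  | start (i : V)
  | deliver (k : Packet V)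
  | crash (i : V)

section Executions

variable {V : Type u} [Fintype V]

/-- The packets that arise when `i` sends each of the messages `ms` to all its out-neighbours. -/
noncomputable def broadcast (G : Digraph V) (i : V) (ms : Multiset (Msg V)) :
    Multiset (Packet V) :=
  ms.bind fun m => (outNbrs G i).val.map fun j => ⟨i, j, m⟩

/-- The initial configuration. -/
def Config.init (input : V → ℝ) : Config V where
  loc := fun i => LocalState.init (input i)
  transit := 0
  crashed := ∅

/-- The steps of the system. Nodes start at arbitrary times and messages are delivered in any
order. A node may crash at any time, also in the middle of a local step, so that an arbitrary part
of the packets of that step is still sent. -/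
inductive Step (G : Digraph V) (f pEnd : ℕ) (mode : Averaging) :
    Config V → Event V → Config V → Prop
  | idle (c : Config V) : Step G f pEnd mode c .idle c
  | start (c : Config V) (i : V) (s : LocalState V) (ms : Multiset (Msg V))
      (alive : i ∉ c.crashed) (fresh : (c.loc i).phase = 0)
      (eq : enter pEnd i 1 (c.loc i) = (s, ms)) :
      Step G f pEnd mode c (.start i)
        { loc := open scoped Classical in Function.update c.loc i s
          transit := c.transit + broadcast G i ms
          crashed := c.crashed }
  | deliver (c : Config V) (k : Packet V) (rest : Multiset (Packet V))
      (s : LocalState V) (ms : Multiset (Msg V))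
      (alive : k.dst ∉ c.crashed) (started : (c.loc k.dst).phase ≠ 0)
      (mem : c.transit = k ::ₘ rest)
      (eq : receive G f pEnd mode k.dst k.msg (c.loc k.dst) = (s, ms)) :
      Step G f pEnd mode c (.deliver k)
        { loc := open scoped Classical in Function.update c.loc k.dst s
          transit := rest + broadcast G k.dst ms
          crashed := c.crashed }
  | crash (c : Config V) (i : V) (alive : i ∉ c.crashed) :
      Step G f pEnd mode c (.crash i)
        { loc := c.loc, transit := c.transit, crashed := insert i c.crashed }
  | crashStart (c : Config V) (i : V) (sent : Multiset (Packet V))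
      (alive : i ∉ c.crashed) (fresh : (c.loc i).phase = 0)
      (part : sent ≤ broadcast G i (enter pEnd i 1 (c.loc i)).2) :
      Step G f pEnd mode c (.crash i)
        { loc := c.loc, transit := c.transit + sent, crashed := insert i c.crashed }
  | crashDeliver (c : Config V) (k : Packet V) (sent : Multiset (Packet V))
      (alive : k.dst ∉ c.crashed) (started : (c.loc k.dst).phase ≠ 0)
      (mem : k ∈ c.transit)
      (part : sent ≤ broadcast G k.dst
        (receive G f pEnd mode k.dst k.msg (c.loc k.dst)).2) :
      Step G f pEnd mode c (.crash k.dst)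
        { loc := c.loc, transit := c.transit + sent, crashed := insert k.dst c.crashed }

/-- An execution of the algorithm with parameters `f`, `pEnd` in the network `G` on the given
inputs: an infinite sequence of steps (some may be idle). -/
structure Execution (G : Digraph V) (f pEnd : ℕ) (mode : Averaging) (input : V → ℝ) where
  cfg : ℕ → Config V
  ev : ℕ → Event V
  init : cfg 0 = Config.init input
  step : ∀ t, Step G f pEnd mode (cfg t) (ev t) (cfg (t + 1))

namespace Execution

variable {G : Digraph V} {f pEnd : ℕ} {mode : Averaging} {input : V → ℝ}

/-- The nodes that crash at some time. -/
def faulty (E : Execution G f pEnd mode input) : Set V :=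
  {i | ∃ t, i ∈ (E.cfg t).crashed}

/-- Fault-free nodes eventually start, and links are reliable: every message in transit to a
fault-free node is eventually delivered. There is no bound on the delays. -/
def Fair (E : Execution G f pEnd mode input) : Prop :=
  (∀ i, i ∉ E.faulty → ∃ t, E.ev t = .start i) ∧
  (∀ t, ∀ k ∈ (E.cfg t).transit, k.dst ∉ E.faulty → ∃ t' ≥ t, E.ev t' = .deliver k)

/-- Node `i` decides on the output `y`. -/
def Outputs (E : Execution G f pEnd mode input) (i : V) (y : ℝ) : Prop :=
  ∃ t, ((E.cfg t).loc i).out = some y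

/-- The outputs at any two fault-free nodes differ by at most `ε`. -/
def Agreement (E : Execution G f pEnd mode input) (ε : ℝ) : Prop :=
  ∀ i j, i ∉ E.faulty → j ∉ E.faulty → ∀ y z, E.Outputs i y → E.Outputs j z → |y - z| ≤ ε

/-- The output at any fault-free node is in the convex hull of all the inputs. -/
def Validity (E : Execution G f pEnd mode input) : Prop :=
  ∀ i, i ∉ E.faulty → ∀ y, E.Outputs i y → y ∈ convexHull ℝ (Set.range input)

/-- Every fault-free node decides on an output after finitely many steps. -/
def Termination (E : Execution G f pEnd mode input) : Prop :=
  ∀ i, i ∉ E.faulty → ∃ y, E.Outputs i y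

end Execution

end Executions

end WaitAverage

namespace WaitAverage

variable {V : Type u}

/-! ### Attainable values and their contraction -/

/-! Safety forgets which node holds which value. A number counts as attainable at level `p + 1` if
it is the average of recorded level-`p` messages whose senders cover some `reach G F i` with at most
`f` nodes in `F`. Every value in the system, at faulty nodes too, is attainable, so validity follows
because averages stay in convex sets. For agreement, the propagation condition forces any two such
reach sets to meet (`PropagationCondition.reach_inter_reach`). A common node contributes the same
value to both averages, because no node issues two values for one phase. The difference of two
averages is the average of all pairwise differences, at most `n ^ 2` of them, and one of these is
zero; hence the diameter of the attainable values shrinks by a factor `1 - 1 / (n + 1) ^ 2` per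
level (`Attainable.abs_sub_le`). The invariant `Safe` carries these facts through an execution.

For termination, take `F` to be the set of faulty nodes. If all fault-free nodes reach a phase,
their messages are relayed along fault-free paths, so each fault-free `i` eventually hears all of
`reach G F i` and WAIT holds. The invariant `Live` ensures that no node stays in a phase after WAIT
has become true (`Execution.eventually_phase`). -/

/-- The average of a finite set of pairs (node, value). -/
noncomputable def mean (mode : Averaging) (S : Finset (V × ℝ)) : ℝ :=
  match mode with
  | .distinctValues => (∑ v ∈ S.image Prod.snd, v) / (S.image Prod.snd).card
  | .perNode => (∑ x ∈ S, x.2) / S.card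

lemma LocalState.average_eq_mean (s : LocalState V) (mode : Averaging) (p : ℕ) :
    s.average mode p = mean mode (s.got p) := by
  cases mode <;> rfl

/-- The values that a node can hold after `p` phases, if the messages in `K` are available. -/
def Attainable (G : Digraph V) (f : ℕ) (mode : Averaging) (input : V → ℝ) (K : Set (Msg V)) :
    ℕ → ℝ → Prop
  | 0, h => h ∈ Set.range input
  | p + 1, h => ∃ (i : V) (S : Finset (V × ℝ)) (F : Finset V), i ∉ F ∧ F.card ≤ f ∧
      reach G F i ⊆ {j | ∃ y, (j, y) ∈ S} ∧ (∀ x ∈ S, ⟨x.2, x.1, p + 1⟩ ∈ K) ∧ h = mean mode S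

section Contraction

variable {G : Digraph V} {f : ℕ} {mode : Averaging} {input : V → ℝ} {K K' : Set (Msg V)}

lemma Attainable.mono (hK : K ⊆ K') {p : ℕ} {h : ℝ} (ha : Attainable G f mode input K p h) :
    Attainable G f mode input K' p h := by
  cases p with
  | zero => exact ha
  | succ p =>
    obtain ⟨i, S, F, hi, hF, hr, hS, rfl⟩ := ha
    exact ⟨i, S, F, hi, hF, hr, fun x hx => hK (hS x hx), rfl⟩

lemma mem_reach_self {F : Finset V} {i : V} (hi : i ∉ F) : i ∈ reach G F i :=
  ⟨hi, Relation.ReflTransGen.refl⟩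

/-! ### Convexity and contraction of averages. -/

lemma avg_mem_of_convex {α : Type*} {T : Finset α} (hT : T.Nonempty) {g : α → ℝ} {s : Set ℝ}
    (hs : Convex ℝ s) (hg : ∀ x ∈ T, g x ∈ s) : (∑ x ∈ T, g x) / T.card ∈ s := by
  have hc : (T.card : ℝ) ≠ 0 := by exact_mod_cast hT.card_pos.ne'
  have := hs.sum_mem (t := T) (w := fun _ => (T.card : ℝ)⁻¹) (z := g)
    (fun _ _ => by positivity) (by simp [hc]) hg
  simpa [← Finset.mul_sum, div_eq_inv_mul] using this

lemma mean_mem_of_convex {S : Finset (V × ℝ)} (hS : S.Nonempty) {s : Set ℝ} (hs : Convex ℝ s)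
    (h : ∀ x ∈ S, x.2 ∈ s) : mean mode S ∈ s := by
  cases mode with
  | distinctValues =>
    refine avg_mem_of_convex (hS.image _) (g := fun v => v) hs fun v hv => ?_
    obtain ⟨x, hx, rfl⟩ := Finset.mem_image.1 hv
    exact h x hx
  | perNode => exact avg_mem_of_convex hS hs h

/-- The difference of the averages is the average of `g x - g' y` over all pairs. The pair `(x₀,
y₀)` contributes zero, the others at most `D` each. Using `n + 1` instead of `n` keeps the
denominator positive for `n = 0`. -/
lemma abs_avg_sub_avg_le {α β : Type*} {T : Finset α} {T' : Finset β} {g : α → ℝ} {g' : β → ℝ}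
    {D : ℝ} {n : ℕ} (hD : ∀ x ∈ T, ∀ y ∈ T', |g x - g' y| ≤ D) {x₀ : α} {y₀ : β} (hx : x₀ ∈ T)
    (hy : y₀ ∈ T') (heq : g x₀ = g' y₀) (hn : T.card ≤ n) (hn' : T'.card ≤ n) :
    |(∑ x ∈ T, g x) / T.card - (∑ y ∈ T', g' y) / T'.card| ≤ D * (1 - 1 / ((n : ℝ) + 1) ^ 2) := by
  classical
  have hD0 : 0 ≤ D := (abs_nonneg _).trans (hD x₀ hx y₀ hy)
  have hc : (0 : ℝ) < T.card := by exact_mod_cast Finset.card_pos.2 ⟨_, hx⟩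
  have hc' : (0 : ℝ) < T'.card := by exact_mod_cast Finset.card_pos.2 ⟨_, hy⟩
  have hcn : (T.card : ℝ) ≤ n + 1 := by exact_mod_cast hn.trans (Nat.le_succ n)
  have hcn' : (T'.card : ℝ) ≤ n + 1 := by exact_mod_cast hn'.trans (Nat.le_succ n)
  have key : (∑ x ∈ T, g x) / T.card - (∑ y ∈ T', g' y) / T'.card
      = (∑ z ∈ T ×ˢ T', (g z.1 - g' z.2)) / (T.card * T'.card) := by
    rw [Finset.sum_product]
    simp only [Finset.sum_sub_distrib, Finset.sum_const, nsmul_eq_mul, ← Finset.mul_sum]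
    field_simp
  have hsum : |∑ z ∈ T ×ˢ T', (g z.1 - g' z.2)| ≤ (T.card * T'.card - 1) * D := by
    have h0 : (x₀, y₀) ∈ T ×ˢ T' := Finset.mk_mem_product hx hy
    rw [← Finset.add_sum_erase _ _ h0]
    simp only [heq, sub_self, zero_add]
    refine (Finset.abs_sum_le_sum_abs _ _).trans ?_
    refine (Finset.sum_le_card_nsmul _ _ D fun z hz => ?_).trans ?_
    · have := Finset.mem_product.1 (Finset.mem_of_mem_erase hz)
      exact hD _ this.1 _ this.2
    · rw [Finset.card_erase_of_mem h0, Finset.card_product, nsmul_eq_mul, Nat.cast_sub]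
      · push_cast; rfl
      · rw [← Finset.card_product]; exact Finset.card_pos.2 ⟨_, h0⟩
  rw [key, abs_div, abs_of_pos (mul_pos hc hc'), div_le_iff₀ (mul_pos hc hc')]
  refine hsum.trans ?_
  have h1 : (T.card * T'.card : ℝ) ≤ (n + 1) ^ 2 := by
    rw [sq]; exact mul_le_mul hcn hcn' hc'.le (by positivity)
  have h2 : 1 / ((n : ℝ) + 1) ^ 2 * (T.card * T'.card) ≤ 1 := by
    rw [div_mul_eq_mul_div, one_mul]
    exact div_le_one_of_le₀ h1 (by positivity)
  nlinarith

lemma abs_mean_sub_mean_le {S S' : Finset (V × ℝ)} {D : ℝ} {n : ℕ}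
    (hD : ∀ x ∈ S, ∀ y ∈ S', |x.2 - y.2| ≤ D) {z : V × ℝ} (hz : z ∈ S) (hz' : z ∈ S')
    (hn : S.card ≤ n) (hn' : S'.card ≤ n) :
    |mean mode S - mean mode S'| ≤ D * (1 - 1 / ((n : ℝ) + 1) ^ 2) := by
  cases mode with
  | distinctValues =>
    refine abs_avg_sub_avg_le (g := fun v => v) (g' := fun v => v) (x₀ := z.2) (y₀ := z.2) ?_
      (Finset.mem_image_of_mem _ hz) (Finset.mem_image_of_mem _ hz') rfl
      (Finset.card_image_le.trans hn) (Finset.card_image_le.trans hn')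
    intro v hv w hw
    obtain ⟨x, hx, rfl⟩ := Finset.mem_image.1 hv
    obtain ⟨y, hy, rfl⟩ := Finset.mem_image.1 hw
    exact hD x hx y hy
  | perNode => exact abs_avg_sub_avg_le hD hz hz' rfl hn hn'

/-- If `A` consists of nodes outside `reach G F j`, it cannot propagate to `reach G F j`. -/
lemma not_propagates_reach [Fintype V] {F A B : Finset V} {j : V} (hF : F.card ≤ f)
    (hB : (B : Set V) = reach G F j) (hAB : Disjoint A B) : ¬ Propagates G f A B := by
  rintro ⟨-, h⟩
  -- A node outside `F` with a link into the reach set belongs to that set itself, so the links from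
  -- `A` into it all start in `F`.
  have hsub : {i : V | i ∈ A ∧ ∃ j ∈ B, j ∈ outNbrs G i} ⊆ (F : Set V) := by
    rintro a ⟨haA, b, hb, hab⟩
    by_contra haF
    have hb' : b ∈ reach G F j := hB ▸ (show b ∈ (B : Set V) from hb)
    have haB : a ∉ B := Finset.disjoint_left.1 hAB haA
    apply haB
    have hadj : G.Adj a b := by
      simp only [outNbrs, Finset.mem_filter, Finset.mem_univ, true_and] at hab
      rcases hab with rfl | hab
      · exact absurd hb haB
      · exact hab
    have : a ∈ reach G F j :=
      ⟨haF, Relation.ReflTransGen.head ⟨hadj, haF, hb'.1⟩ hb'.2⟩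
    rw [← hB] at this
    exact this
  have := (Set.ncard_le_ncard hsub (Set.toFinite _))
  rw [Set.ncard_coe_finset] at this
  omega

/-- If the two reach sets were disjoint, they would serve as `L` and `R`, with all other nodes in
`C`. Links into either set from outside start only in `F` or `F'`, at most `f` nodes, so propagation
fails both ways. -/
lemma PropagationCondition.reach_inter_reach [Fintype V] (hG : PropagationCondition G f)
    {F F' : Finset V} {i j : V} (hi : i ∉ F) (hj : j ∉ F') (hF : F.card ≤ f) (hF' : F'.card ≤ f) :
    ∃ k, k ∈ reach G F i ∧ k ∈ reach G F' j := by
  classical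
  by_contra! hcon
  set L : Finset V := (reach G F i).toFinset with hL
  set R : Finset V := (reach G F' j).toFinset with hR
  have hLR : Disjoint L R := by
    rw [Finset.disjoint_left]; intro k hk hk'
    exact hcon k (by simpa [hL] using hk) (by simpa [hR] using hk')
  have h1 : Disjoint L (L ∪ R)ᶜ :=
    Finset.disjoint_left.2 fun a ha hb => by simp [ha] at hb
  have h2 : Disjoint (L ∪ R)ᶜ R :=
    Finset.disjoint_left.2 fun a hb ha => by simp [ha] at hb
  have h3 : L ∪ (L ∪ R)ᶜ ∪ R = Finset.univ := by
    ext a; simp only [Finset.mem_union, Finset.mem_compl, Finset.mem_univ, iff_true]; tauto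
  rcases hG L (L ∪ R)ᶜ R h1 hLR h2 (by convert h3) ⟨i, by simpa [hL] using mem_reach_self hi⟩
    ⟨j, by simpa [hR] using mem_reach_self hj⟩ with h | h
  · refine not_propagates_reach (j := j) hF' (by simp [hR]) ?_ h
    convert Finset.disjoint_union_left.2 ⟨hLR, h2⟩
  · refine not_propagates_reach (j := i) hF (by simp [hL]) ?_ h
    convert Finset.disjoint_union_left.2 ⟨h1.symm, hLR.symm⟩

lemma Attainable.mem_convexHull (hK : ∀ m ∈ K, Attainable G f mode input K (m.phase - 1) m.value)
    {p : ℕ} {h : ℝ} (ha : Attainable G f mode input K p h) :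
    h ∈ convexHull ℝ (Set.range input) := by
  induction p generalizing h with
  | zero => exact subset_convexHull _ _ ha
  | succ p ih =>
    obtain ⟨i, S, F, hi, hF, hr, hS, rfl⟩ := ha
    -- The trivial path puts `i` in its own reach set, so `S` is not empty.
    obtain ⟨y, hy⟩ := hr (mem_reach_self hi)
    exact mean_mem_of_convex ⟨_, hy⟩ (convex_convexHull _ _) fun x hx => ih (hK _ (hS x hx))

lemma card_le_of_unique_value [Fintype V]
    (hu : ∀ m ∈ K, ∀ m' ∈ K, m.sender = m'.sender → m.phase = m'.phase → m.value = m'.value)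
    {S : Finset (V × ℝ)} {p : ℕ} (hS : ∀ x ∈ S, ⟨x.2, x.1, p⟩ ∈ K) :
    S.card ≤ Fintype.card V := by
  refine Finset.card_le_card_of_injOn (t := Finset.univ) Prod.fst (fun _ _ => Finset.mem_univ _) ?_
  intro x hx y hy hxy
  exact Prod.ext hxy (hu _ (hS x hx) _ (hS y hy) hxy rfl)

/-- Induction on the level: the induction hypothesis bounds all pairwise differences of the averaged
values, and a node `k` in both reach sets supplies the shared pair that gives the contraction. -/
lemma Attainable.abs_sub_le [Fintype V] (hG : PropagationCondition G f)
    (hK : ∀ m ∈ K, Attainable G f mode input K (m.phase - 1) m.value)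
    (hu : ∀ m ∈ K, ∀ m' ∈ K, m.sender = m'.sender → m.phase = m'.phase → m.value = m'.value)
    {a b : ℝ} (hin : ∀ i, input i ∈ Set.Icc a b) {p : ℕ} {h h' : ℝ}
    (ha : Attainable G f mode input K p h) (ha' : Attainable G f mode input K p h') :
    |h - h'| ≤ (b - a) * (1 - 1 / ((Fintype.card V : ℝ) + 1) ^ 2) ^ p := by
  induction p generalizing h h' with
  | zero =>
    obtain ⟨i, rfl⟩ := ha
    obtain ⟨j, rfl⟩ := ha'
    have hi := hin i
    have hj := hin j
    rw [pow_zero, mul_one, abs_le]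
    constructor <;> linarith [hi.1, hi.2, hj.1, hj.2]
  | succ p ih =>
    obtain ⟨i, S, F, hi, hF, hr, hS, rfl⟩ := ha
    obtain ⟨j, S', F', hj, hF', hr', hS', rfl⟩ := ha'
    obtain ⟨k, hk, hk'⟩ := hG.reach_inter_reach hi hj hF hF'
    obtain ⟨y, hy⟩ := hr hk
    obtain ⟨y', hy'⟩ := hr' hk'
    obtain rfl : y = y' := hu _ (hS _ hy) _ (hS' _ hy') rfl rfl
    rw [pow_succ, ← mul_assoc]
    exact abs_mean_sub_mean_le (fun x hx x' hx' => ih (hK _ (hS x hx)) (hK _ (hS' x' hx')))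
      hy hy' (card_le_of_unique_value hu hS) (card_le_of_unique_value hu hS')

end Contraction

/-! ### The effect of a local step -/

/-- All messages that are stored at a node. -/
def LocalState.known (s : LocalState V) : Set (Msg V) :=
  {m | m ∈ s.received ∨ (m.sender, m.value) ∈ s.got m.phase}

/-- The same phase, value and output. -/
def LocalState.SameCore (s s' : LocalState V) : Prop :=
  s'.phase = s.phase ∧ s'.val = s.val ∧ s'.out = s.out

lemma LocalState.mem_store_got {s : LocalState V} {m : Msg V} {p : ℕ} {x : V × ℝ} :
    x ∈ (s.store m).got p ↔ x ∈ s.got p ∨ (p = m.phase ∧ x = (m.sender, m.value)) := by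
  classical
  simp only [store, record, Function.update_apply]
  split_ifs with h
  · subst h; simp [or_comm]
  · simp [h]

lemma LocalState.mem_record_got {s : LocalState V} {q p : ℕ} {j : V} {h : ℝ} {x : V × ℝ} :
    x ∈ (s.record q j h).got p ↔ x ∈ s.got p ∨ (p = q ∧ x = (j, h)) := by
  classical
  simp only [record, Function.update_apply]
  split_ifs with h
  · subst h; simp [or_comm]
  · simp [h]

lemma enter_received (pEnd : ℕ) (i : V) (p : ℕ) (s : LocalState V) :
    (enter pEnd i p s).1.received = s.received := by
  unfold enter; split_ifs <;> rfl

lemma enter_phase (pEnd : ℕ) (i : V) (p : ℕ) (s : LocalState V) :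
    (enter pEnd i p s).1.phase = p := by
  unfold enter; split_ifs <;> rfl

lemma enter_val (pEnd : ℕ) (i : V) (p : ℕ) (s : LocalState V) :
    (enter pEnd i p s).1.val = s.val := by
  unfold enter; split_ifs <;> rfl

lemma enter_out (pEnd : ℕ) (i : V) (p : ℕ) (s : LocalState V) :
    (enter pEnd i p s).1.out = if p ≤ pEnd then s.out else some s.val := by
  unfold enter; split_ifs <;> rfl

lemma mem_enter_sent {pEnd : ℕ} {i : V} {p : ℕ} {s : LocalState V} {m : Msg V} :
    m ∈ (enter pEnd i p s).2 ↔ m = ⟨s.val, i, p⟩ ∧ p ≤ pEnd := by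
  unfold enter; split_ifs with h <;> simp [h]

lemma mem_enter_got {pEnd : ℕ} {i : V} {p q : ℕ} {s : LocalState V} {x : V × ℝ} :
    x ∈ (enter pEnd i p s).1.got q ↔ x ∈ s.got q ∨ (p ≤ pEnd ∧ q = p ∧ x = (i, s.val)) := by
  unfold enter; split_ifs with h
  · have := LocalState.mem_record_got (s := s) (q := p) (p := q) (j := i) (h := s.val) (x := x)
    simpa [h] using this
  · simp [h]

lemma mem_known_enter {pEnd : ℕ} {i : V} {p : ℕ} {s : LocalState V} {m : Msg V} :
    m ∈ (enter pEnd i p s).1.known ↔ m ∈ s.known ∨ (m = ⟨s.val, i, p⟩ ∧ p ≤ pEnd) := by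
  obtain ⟨h, j, q⟩ := m
  simp only [LocalState.known, Set.mem_ofPred_eq, enter_received, mem_enter_got, Prod.mk.injEq,
    Msg.mk.injEq]
  tauto

lemma LocalState.mem_known_store {s : LocalState V} {m m' : Msg V} :
    m' ∈ (s.store m).known ↔ m' ∈ s.known ∨ m' = m := by
  obtain ⟨h, j, q⟩ := m
  obtain ⟨h', j', q'⟩ := m'
  simp only [LocalState.known, Set.mem_ofPred_eq, mem_store_got, Prod.mk.injEq, Msg.mk.injEq]
  simp only [store, Set.mem_insert_iff, Msg.mk.injEq]
  tauto

/-- What happens at node `i` when it goes from `s₀` to `s` in one local step, in which it receives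
the messages in `A` (at most one) and sends the messages in `ms`. -/
structure Outcome (G : Digraph V) (f pEnd : ℕ) (mode : Averaging) (i : V) (s₀ : LocalState V)
    (A : Set (Msg V)) (s : LocalState V) (ms : Multiset (Msg V)) : Prop where
  mem_received : ∀ m, m ∈ s.received ↔ m ∈ s₀.received ∨ m ∈ A
  sent : ∀ m ∈ A, m ∉ s₀.received → m ∈ ms
  got_mono : ∀ p, s₀.got p ⊆ s.got p
  got_new : ∀ m ∈ A, m ∉ s₀.received → (m.sender, m.value) ∈ s.got m.phase
  core : (s₀.SameCore s ∧ (∀ m ∈ ms, m ∈ A) ∧ (∀ m ∈ s.known, m ∈ s₀.known ∨ m ∈ A) ∧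
      (s = s₀ ∨ ∃ m ∈ A, s = s₀.store m ∧ ¬ (m.phase = s₀.phase ∧ Wait G f i s s.phase))) ∨
    (∃ v, s.phase = s₀.phase + 1 ∧ s.val = v ∧
      s.out = (if s₀.phase + 1 ≤ pEnd then s₀.out else some v) ∧
      (∀ m, m ∈ ms ∨ m ∈ s.known →
        m ∈ s₀.known ∨ m ∈ A ∨ (m = ⟨v, i, s₀.phase + 1⟩ ∧ s₀.phase + 1 ≤ pEnd)) ∧
      (s₀.phase + 1 ≤ pEnd → ⟨v, i, s₀.phase + 1⟩ ∈ ms) ∧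
      ((s₀.phase = 0 ∧ v = s₀.val) ∨
        ∃ m ∈ A, m.phase = s₀.phase ∧ Wait G f i (s₀.store m) s₀.phase ∧
          v = mean mode ((s₀.store m).got s₀.phase)))

lemma Outcome.known_mono {G : Digraph V} {f pEnd : ℕ} {mode : Averaging} {i : V} {s₀ s : LocalState V} {A : Set (Msg V)} {ms : Multiset (Msg V)}
    (h : Outcome G f pEnd mode i s₀ A s ms) : s₀.known ⊆ s.known := by
  rintro m (hm | hm)
  · exact .inl ((h.mem_received m).2 (.inl hm))
  · exact .inr (h.got_mono _ hm)

lemma outcome_enter (G : Digraph V) (f pEnd : ℕ) (mode : Averaging) (i : V) (s : LocalState V)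
    (hs : s.phase = 0) :
    Outcome G f pEnd mode i s ∅ (enter pEnd i 1 s).1 (enter pEnd i 1 s).2 where
  mem_received m := by simp [enter_received]
  sent m hm := hm.elim
  got_mono p x hx := mem_enter_got.2 (.inl hx)
  got_new m hm := hm.elim
  core := by
    refine .inr ⟨s.val, by rw [enter_phase, hs], enter_val .., by rw [enter_out, hs], ?_, ?_,
      .inl ⟨hs, rfl⟩⟩
    · intro m hm
      rw [mem_enter_sent, mem_known_enter] at hm
      rw [hs]; tauto
    · intro h
      rw [hs] at h ⊢
      exact mem_enter_sent.2 ⟨rfl, h⟩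

lemma outcome_receive (G : Digraph V) (f pEnd : ℕ) (mode : Averaging) (i : V) (m : Msg V)
    (s : LocalState V) :
    Outcome G f pEnd mode i s {m} (receive G f pEnd mode i m s).1
      (receive G f pEnd mode i m s).2 := by
  unfold receive
  split_ifs with h1 h2
  · refine ⟨?_, ?_, fun p => subset_rfl, ?_, .inl ⟨⟨rfl, rfl, rfl⟩, by simp, ?_, .inl rfl⟩⟩
    · rintro m'
      simp only [Set.mem_singleton_iff, iff_self_or]
      rintro rfl; exact h1
    · rintro m' rfl h; exact absurd h1 h
    · rintro m' rfl h; exact absurd h1 h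
    · exact fun m' h => .inl h
  · refine ⟨?_, ?_, ?_, ?_, .inr ⟨_, enter_phase .., enter_val .., enter_out .., ?_, ?_,
      .inr ⟨m, rfl, h2.1, h2.2, ?_⟩⟩⟩
    · intro m'
      rw [enter_received]
      exact Set.mem_insert_iff.trans or_comm
    · rintro m' rfl -
      exact Multiset.mem_cons_self _ _
    · intro p x hx
      exact mem_enter_got.2 (.inl (LocalState.mem_store_got.2 (.inl hx)))
    · rintro m' rfl -
      exact mem_enter_got.2 (.inl (LocalState.mem_store_got.2 (.inr ⟨rfl, rfl⟩)))
    · intro m' hm'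
      rw [Multiset.mem_cons, mem_enter_sent, mem_known_enter] at hm'
      -- Averaging changes only the current value, not the stored messages.
      have : m' ∈ ((s.store m).doAverage mode).known ↔ m' ∈ (s.store m).known := Iff.rfl
      rw [this, LocalState.mem_known_store] at hm'
      simp only [Set.mem_singleton_iff]
      tauto
    · intro h
      exact Multiset.mem_cons_of_mem (mem_enter_sent.2 ⟨rfl, h⟩)
    · exact LocalState.average_eq_mean ..
  · refine ⟨?_, ?_, ?_, ?_, .inl ⟨⟨rfl, rfl, rfl⟩, by simp, ?_, .inr ⟨m, rfl, rfl, h2⟩⟩⟩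
    · intro m'
      exact Set.mem_insert_iff.trans or_comm
    · rintro m' rfl -
      simp
    · intro p x hx
      exact LocalState.mem_store_got.2 (.inl hx)
    · rintro m' rfl -
      exact LocalState.mem_store_got.2 (.inr ⟨rfl, rfl⟩)
    · intro m' hm'
      exact LocalState.mem_known_store.1 hm'

/-! ### Steps of the system -/

/-- All messages that have been sent or stored. -/
def Config.known (c : Config V) : Set (Msg V) :=
  {m | (∃ k ∈ c.transit, k.msg = m) ∨ ∃ i, m ∈ (c.loc i).known}

/-- The message `m` has been sent by `a` to `b` and is in transit, or `b` has received it. -/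
def Config.Available (c : Config V) (a b : V) (m : Msg V) : Prop :=
  ⟨a, b, m⟩ ∈ c.transit ∨ m ∈ (c.loc b).received

section Steps

variable [Fintype V] {G : Digraph V} {f pEnd : ℕ} {mode : Averaging}

lemma mem_broadcast {i : V} {ms : Multiset (Msg V)} {k : Packet V} :
    k ∈ broadcast G i ms ↔ k.src = i ∧ k.dst ∈ outNbrs G i ∧ k.msg ∈ ms := by
  obtain ⟨a, b, m⟩ := k
  simp only [broadcast, Multiset.mem_bind, Multiset.mem_map, Finset.mem_val, Packet.mk.injEq]
  constructor
  · rintro ⟨m', hm', j, hj, rfl, rfl, rfl⟩; exact ⟨rfl, hj, hm'⟩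
  · rintro ⟨rfl, hb, hm⟩; exact ⟨m, hm, b, hb, rfl, rfl, rfl⟩

/-- A step without effect on the local states and the messages, or a local step of a node `i`,
in the course of which `i` may crash. -/
lemma Step.outcome {c c' : Config V} {e : Event V} (h : Step G f pEnd mode c e c') :
    (c'.loc = c.loc ∧ c'.transit = c.transit ∧ c.crashed ⊆ c'.crashed) ∨
    ∃ i A s ms, i ∉ c.crashed ∧ c.crashed ⊆ c'.crashed ∧ A ⊆ c.known ∧
      Outcome G f pEnd mode i (c.loc i) A s ms ∧
      (∀ k ∈ c'.transit, k ∈ c.transit ∨ k ∈ broadcast G i ms) ∧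
      ((i ∈ c'.crashed ∧ c'.loc = c.loc ∧ ∀ k ∈ c.transit, k ∈ c'.transit) ∨
        (c'.loc i = s ∧ (∀ j, j ≠ i → c'.loc j = c.loc j) ∧
          (∀ k ∈ c.transit, k ∈ c'.transit ∨ (k.dst = i ∧ k.msg ∈ A)) ∧
          ∀ k ∈ broadcast G i ms, k ∈ c'.transit)) := by
  classical
  cases h with
  | idle => exact .inl ⟨rfl, rfl, subset_rfl⟩
  | crash i alive => exact .inl ⟨rfl, rfl, Set.subset_insert _ _⟩
  | start i s ms alive fresh eq =>
    have ho := outcome_enter G f pEnd mode i _ fresh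
    rw [eq] at ho
    refine .inr ⟨i, ∅, s, ms, alive, subset_rfl, Set.empty_subset _, ho,
      fun k hk => Multiset.mem_add.1 hk, .inr ⟨?_, fun j hj => ?_, fun k hk => ?_, fun k hk => ?_⟩⟩
    · simp
    · simp [hj]
    · exact .inl (Multiset.mem_add.2 (.inl hk))
    · exact Multiset.mem_add.2 (.inr hk)
  | deliver k rest s ms alive started mem eq =>
    have ho := outcome_receive G f pEnd mode k.dst k.msg (c.loc k.dst)
    rw [eq] at ho
    refine .inr ⟨k.dst, {k.msg}, s, ms, alive, subset_rfl, ?_, ho,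
      fun k' hk => ?_, .inr ⟨?_, fun j hj => ?_, fun k' hk => ?_, fun k' hk => ?_⟩⟩
    · rintro _ rfl
      exact .inl ⟨k, by simp [mem], rfl⟩
    · rw [mem]
      refine (Multiset.mem_add.1 hk).imp_left Multiset.mem_cons_of_mem
    · simp
    · simp [hj]
    · rw [mem, Multiset.mem_cons] at hk
      rcases hk with rfl | hk
      · exact .inr ⟨rfl, rfl⟩
      · exact .inl (Multiset.mem_add.2 (.inl hk))
    · exact Multiset.mem_add.2 (.inr hk)
  | crashStart i sent alive fresh part =>
    refine .inr ⟨i, ∅, _, _, alive, Set.subset_insert _ _, Set.empty_subset _,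
      outcome_enter G f pEnd mode i _ fresh, fun k hk => ?_,
      .inl ⟨Set.mem_insert _ _, rfl, fun k hk => Multiset.mem_add.2 (.inl hk)⟩⟩
    exact (Multiset.mem_add.1 hk).imp_right (Multiset.mem_of_le part)
  | crashDeliver k sent alive started mem part =>
    refine .inr ⟨k.dst, {k.msg}, _, _, alive, Set.subset_insert _ _, ?_,
      outcome_receive G f pEnd mode k.dst k.msg _, fun k hk => ?_,
      .inl ⟨Set.mem_insert _ _, rfl, fun k hk => Multiset.mem_add.2 (.inl hk)⟩⟩
    · rintro _ rfl
      exact .inl ⟨k, mem, rfl⟩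
    · exact (Multiset.mem_add.1 hk).imp_right (Multiset.mem_of_le part)

/-- A delivered packet leaves the channel, but its message stays in the memory of the receiver. -/
lemma Step.known_mono {c c' : Config V} {e : Event V} (h : Step G f pEnd mode c e c') :
    c.known ⊆ c'.known := by
  rcases h.outcome with ⟨hl, ht, -⟩ | ⟨i, A, s, ms, -, -, -, ho, -, ⟨-, hl, ht⟩ | ⟨hi, hj, ht, -⟩⟩
  · unfold Config.known; rw [hl, ht]
  · rintro m (⟨k, hk, rfl⟩ | ⟨j, hm⟩)
    · exact .inl ⟨k, ht k hk, rfl⟩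
    · exact .inr ⟨j, by rwa [hl]⟩
  · rintro m (⟨k, hk, rfl⟩ | ⟨j, hm⟩)
    · rcases ht k hk with hk | ⟨-, hk⟩
      · exact .inl ⟨k, hk, rfl⟩
      · exact .inr ⟨i, .inl (hi ▸ (ho.mem_received _).2 (.inr hk))⟩
    · refine .inr ⟨j, ?_⟩
      by_cases hji : j = i
      · subst hji; rw [hi]; exact ho.known_mono hm
      · rwa [hj j hji]

lemma Step.crashed_mono {c c' : Config V} {e : Event V} (h : Step G f pEnd mode c e c') :
    c.crashed ⊆ c'.crashed := by
  rcases h.outcome with ⟨-, -, h⟩ | ⟨_, _, _, _, -, h, -⟩ <;> exact h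

lemma Step.received_mono {c c' : Config V} {e : Event V} (h : Step G f pEnd mode c e c') (a : V) :
    (c.loc a).received ⊆ (c'.loc a).received := by
  rcases h.outcome with ⟨hl, -, -⟩ | ⟨i, A, s, ms, -, -, -, ho, -, ⟨-, hl, -⟩ | ⟨hi, hj, -, -⟩⟩
  · rw [hl]
  · rw [hl]
  · by_cases hai : a = i
    · subst hai; rw [hi]; exact fun m hm => (ho.mem_received m).2 (.inl hm)
    · rw [hj a hai]

lemma Step.available_mono {c c' : Config V} {e : Event V} (h : Step G f pEnd mode c e c')
    {a b : V} {m : Msg V} (hm : c.Available a b m) : c'.Available a b m := by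
  rcases hm with hm | hm
  · rcases h.outcome with ⟨-, ht, -⟩ | ⟨i, A, s, ms, -, -, -, ho, -, ⟨-, -, ht⟩ | ⟨hi, -, ht, -⟩⟩
    · exact .inl (ht ▸ hm)
    · exact .inl (ht _ hm)
    · rcases ht _ hm with hm | ⟨hb, hm⟩
      · exact .inl hm
      · simp only at hb hm
        subst hb
        exact .inr (hi ▸ (ho.mem_received _).2 (.inr hm))
  · exact .inr (h.received_mono b hm)

lemma Step.phase_mono {c c' : Config V} {e : Event V} (h : Step G f pEnd mode c e c') (a : V) :
    (c.loc a).phase ≤ (c'.loc a).phase := by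
  rcases h.outcome with ⟨hl, -, -⟩ | ⟨i, A, s, ms, -, -, -, ho, -, ⟨-, hl, -⟩ | ⟨hi, hj, -, -⟩⟩
  · rw [hl]
  · rw [hl]
  · by_cases hai : a = i
    · subst hai; rw [hi]
      rcases ho.core with ⟨h, -⟩ | ⟨v, h, -⟩
      · exact h.1.ge
      · omega
    · rw [hj a hai]

end Steps

/-! ### Invariants -/

section Invariants

lemma Wait.of_got_subset {G : Digraph V} {f : ℕ} {i : V} {s s' : LocalState V} {p : ℕ} (h : Wait G f i s p)
    (hs : s.got p ⊆ s'.got p) : Wait G f i s' p := by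
  obtain ⟨F, hi, hF, hr⟩ := h
  exact ⟨F, hi, hF, hr.trans fun j ⟨y, hy⟩ => ⟨y, hs hy⟩⟩

variable {G : Digraph V} {f pEnd : ℕ} {mode : Averaging} {input : V → ℝ}

/-- The invariant behind agreement and validity. -/
structure Safe (G : Digraph V) (f pEnd : ℕ) (mode : Averaging) (input : V → ℝ) (c : Config V) :
    Prop where
  unique : ∀ m ∈ c.known, ∀ m' ∈ c.known,
    m.sender = m'.sender → m.phase = m'.phase → m.value = m'.value
  -- Crashed senders are exempt: a node that crashes while entering a phase may have sent its new
  -- message although its local state has not advanced.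
  fresh : ∀ m ∈ c.known, m.sender ∉ c.crashed → m.phase ≤ (c.loc m.sender).phase
  one_le : ∀ m ∈ c.known, 1 ≤ m.phase
  le_pEnd : ∀ m ∈ c.known, m.phase ≤ pEnd
  -- A message of phase `p` carries `v[p - 1]`, a value of level `p - 1`.
  attainable : ∀ m ∈ c.known, Attainable G f mode input c.known (m.phase - 1) m.value
  -- Truncated subtraction gives level `0` both before the start and in phase `1`.
  attainable_val : ∀ i, Attainable G f mode input c.known ((c.loc i).phase - 1) (c.loc i).val
  phase_le : ∀ i, (c.loc i).phase ≤ pEnd + 1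
  out_iff : ∀ i y, (c.loc i).out = some y ↔ (c.loc i).phase = pEnd + 1 ∧ (c.loc i).val = y

lemma safe_init : Safe G f pEnd mode input (Config.init input) := by
  have h : ∀ m, m ∉ (Config.init input).known := by
    rintro m (⟨k, hk, -⟩ | ⟨i, hm | hm⟩)
    · exact absurd hk (Multiset.notMem_zero k)
    · exact hm
    · exact absurd hm (Finset.notMem_empty _)
  refine ⟨fun m hm => (h m hm).elim, fun m hm => (h m hm).elim, fun m hm => (h m hm).elim,
    fun m hm => (h m hm).elim, fun m hm => (h m hm).elim, fun i => ⟨i, rfl⟩, fun i => Nat.zero_le _,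
    fun i y => ?_⟩
  simp [Config.init, LocalState.init]

variable [Fintype V]

/-- The effect of a step on the messages and on the phases, values and outputs: nothing new
happens, or a node `i` enters its next phase with a new value `v` (and possibly crashes). -/
lemma Step.transition {c c' : Config V} {e : Event V} (h : Step G f pEnd mode c e c')
    (hs : Safe G f pEnd mode input c) :
    (c'.known ⊆ c.known ∧ ∀ j, (c.loc j).SameCore (c'.loc j)) ∨
    ∃ i v, i ∉ c.crashed ∧ (c.loc i).phase ≤ pEnd ∧
      Attainable G f mode input c.known (c.loc i).phase v ∧
      (∀ m ∈ c'.known, m ∈ c.known ∨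
        (m = ⟨v, i, (c.loc i).phase + 1⟩ ∧ (c.loc i).phase + 1 ≤ pEnd)) ∧
      (∀ j, j ≠ i → (c.loc j).SameCore (c'.loc j)) ∧
      ((i ∈ c'.crashed ∧ (c.loc i).SameCore (c'.loc i)) ∨
        ((c'.loc i).phase = (c.loc i).phase + 1 ∧ (c'.loc i).val = v ∧
          (c'.loc i).out = if (c.loc i).phase + 1 ≤ pEnd then (c.loc i).out else some v)) := by
  rcases h.outcome with ⟨hl, ht, -⟩ | ⟨i, A, s, ms, hi, hcr, hA, ho, ht, hloc⟩
  · refine .inl ⟨?_, fun j => ?_⟩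
    · unfold Config.known; rw [hl, ht]
    · rw [hl]; exact ⟨rfl, rfl, rfl⟩
  have hknown : ∀ m ∈ c'.known, m ∈ c.known ∨ m ∈ ms ∨ m ∈ s.known := by
    rintro m (⟨k, hk, rfl⟩ | ⟨j, hm⟩)
    · rcases ht k hk with hk | hk
      · exact .inl (.inl ⟨k, hk, rfl⟩)
      · exact .inr (.inl (mem_broadcast.1 hk).2.2)
    · rcases hloc with ⟨-, hl, -⟩ | ⟨hl, hne, -⟩
      · exact .inl (.inr ⟨j, by rwa [hl] at hm⟩)
      · by_cases hji : j = i
        · subst hji; exact .inr (.inr (by rwa [hl] at hm))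
        · exact .inl (.inr ⟨j, by rwa [hne j hji] at hm⟩)
  have hsame : ∀ j, j ≠ i → (c.loc j).SameCore (c'.loc j) := by
    intro j hj
    rcases hloc with ⟨-, hl, -⟩ | ⟨hl, hne, -⟩
    · rw [hl]; exact ⟨rfl, rfl, rfl⟩
    · rw [hne j hj]; exact ⟨rfl, rfl, rfl⟩
  rcases ho.core with ⟨hcore, hms, hkn, -⟩ | ⟨v, hph, hv, hout, hms, -, hatt⟩
  · refine .inl ⟨fun m hm => ?_, fun j => ?_⟩
    · rcases hknown m hm with hm | hm | hm
      · exact hm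
      · exact hA (hms m hm)
      · exact (hkn m hm).elim (fun h => .inr ⟨i, h⟩) fun h => hA h
    · by_cases hji : j = i
      · subst hji
        rcases hloc with ⟨-, hl, -⟩ | ⟨hl, -⟩
        · rw [hl]; exact ⟨rfl, rfl, rfl⟩
        · rwa [hl]
      · exact hsame j hji
  · refine .inr ⟨i, v, hi, ?_, ?_, ?_, hsame, ?_⟩
    -- A node past its last phase cannot advance, since no message has phase `pEnd + 1`.
    · rcases hatt with ⟨h0, -⟩ | ⟨m, hm, hp, -⟩
      · omega
      · exact hp ▸ hs.le_pEnd m (hA hm)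
    · rcases hatt with ⟨h0, rfl⟩ | ⟨m, hm, hp, ⟨F, hiF, hF, hr⟩, rfl⟩
      · have := hs.attainable_val i
        rwa [h0] at this ⊢
      -- The triggering message has positive phase, so the node has started and the new value is of
      -- level at least one.
      · have h1 := hs.one_le m (hA hm)
        obtain ⟨p, hp'⟩ : ∃ p, (c.loc i).phase = p + 1 := ⟨(c.loc i).phase - 1, by omega⟩
        rw [hp'] at hr ⊢
        refine ⟨i, _, F, hiF, hF, hr, fun x hx => ?_, rfl⟩
        rcases LocalState.mem_store_got.1 hx with hx | ⟨hpm, rfl⟩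
        · exact .inr ⟨i, .inr hx⟩
        · rw [hpm]; exact hA hm
    · intro m hm
      rcases hknown m hm with hm | hm
      · exact .inl hm
      · rcases hms m hm with h | h | h
        · exact .inl (.inr ⟨i, h⟩)
        · exact .inl (hA h)
        · exact .inr h
    · rcases hloc with ⟨hic, hl, -⟩ | ⟨hl, -⟩
      · rw [hl]; exact .inl ⟨hic, rfl, rfl, rfl⟩
      · rw [hl]; exact .inr ⟨hph, hv, hout⟩

/-- The only possible new message is the one with which `i` enters its next phase. Uniqueness
survives because an alive node has issued no message beyond its current phase. -/
lemma Safe.step {c c' : Config V} {e : Event V} (hs : Safe G f pEnd mode input c)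
    (h : Step G f pEnd mode c e c') : Safe G f pEnd mode input c' := by
  have hK := h.known_mono
  have hC := h.crashed_mono
  rcases h.transition hs with ⟨hk, hcore⟩ | ⟨i, v, hi, hp, hatt, hk, hsame, hloc⟩
  · refine ⟨fun m hm m' hm' => hs.unique m (hk hm) m' (hk hm'), fun m hm hmc => ?_,
      fun m hm => hs.one_le m (hk hm), fun m hm => hs.le_pEnd m (hk hm),
      fun m hm => (hs.attainable m (hk hm)).mono hK, fun i => ?_, fun i => ?_,
      fun i y => ?_⟩
    · rw [(hcore m.sender).1]
      exact hs.fresh m (hk hm) fun h => hmc (hC h)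
    · rw [(hcore i).1, (hcore i).2.1]; exact (hs.attainable_val i).mono hK
    · rw [(hcore i).1]; exact hs.phase_le i
    · rw [(hcore i).1, (hcore i).2.1, (hcore i).2.2]; exact hs.out_iff i y
  · have hold : ∀ m ∈ c.known, m.sender = i → m.phase ≠ (c.loc i).phase + 1 := by
      rintro m hm rfl h
      have := hs.fresh m hm hi
      omega
    refine ⟨fun m hm m' hm' hsd hph => ?_, fun m hm hmc => ?_, fun m hm => ?_, fun m hm => ?_,
      fun m hm => ?_, fun j => ?_, fun j => ?_, fun j y => ?_⟩
    · rcases hk m hm with hm | ⟨rfl, -⟩ <;> rcases hk m' hm' with hm' | ⟨rfl, -⟩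
      · exact hs.unique m hm m' hm' hsd hph
      · exact absurd hph (hold m hm hsd)
      · exact absurd hph.symm (hold m' hm' hsd.symm)
      · rfl
    · rcases hk m hm with hm | ⟨rfl, -⟩
      · exact (hs.fresh m hm fun h => hmc (hC h)).trans (h.phase_mono _)
      · rcases hloc with ⟨hic, -⟩ | ⟨hph, -⟩
        · exact absurd hic hmc
        · exact hph.ge
    · rcases hk m hm with hm | ⟨rfl, -⟩
      · exact hs.one_le m hm
      · exact Nat.le_add_left _ _
    · rcases hk m hm with hm | ⟨rfl, hle⟩
      · exact hs.le_pEnd m hm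
      · exact hle
    · rcases hk m hm with hm | ⟨rfl, -⟩
      · exact (hs.attainable m hm).mono hK
      · exact hatt.mono hK
    · have hsc : (c.loc j).SameCore (c'.loc j) →
          Attainable G f mode input c'.known ((c'.loc j).phase - 1) (c'.loc j).val := fun hsc => by
        rw [hsc.1, hsc.2.1]; exact (hs.attainable_val j).mono hK
      by_cases hji : j = i
      · subst hji
        rcases hloc with ⟨-, hsc'⟩ | ⟨hph, hv, -⟩
        · exact hsc hsc'
        · rw [hph, hv]; exact hatt.mono hK
      · exact hsc (hsame j hji)
    · by_cases hji : j = i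
      · subst hji
        have := hs.phase_le j
        rcases hloc with ⟨-, hsc⟩ | ⟨hph, -⟩
        · rwa [hsc.1]
        · omega
      · rw [(hsame j hji).1]; exact hs.phase_le j
    · have hsc : (c.loc j).SameCore (c'.loc j) →
          ((c'.loc j).out = some y ↔ (c'.loc j).phase = pEnd + 1 ∧ (c'.loc j).val = y) :=
        fun hsc => by rw [hsc.1, hsc.2.1, hsc.2.2]; exact hs.out_iff j y
      by_cases hji : j = i
      · subst hji
        rcases hloc with ⟨-, hsc'⟩ | ⟨hph, hv, hout⟩
        · exact hsc hsc'
        · rw [hph, hv, hout]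
          -- Before the last phase is over, both sides of the equivalence are false; otherwise the
          -- new phase is exactly `pEnd + 1`.
          split_ifs with hle
          · rw [hs.out_iff]
            constructor <;> intro h <;> omega
          · rw [Option.some_inj]
            exact ⟨fun h => ⟨by omega, h⟩, fun h => h.2⟩
      · exact hsc (hsame j hji)

/-- The invariant behind termination. -/
structure Live (G : Digraph V) (f pEnd : ℕ) (c : Config V) : Prop where
  got : ∀ a, ∀ m ∈ (c.loc a).received, (m.sender, m.value) ∈ (c.loc a).got m.phase
  relay : ∀ a, ∀ m ∈ (c.loc a).received, ∀ b ∈ outNbrs G a, c.Available a b m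
  own : ∀ a p, 1 ≤ p → p ≤ (c.loc a).phase → p ≤ pEnd →
    ∃ y, ∀ b ∈ outNbrs G a, c.Available a b ⟨y, a, p⟩
  wait : ∀ a y, ⟨y, a, (c.loc a).phase⟩ ∈ (c.loc a).received →
    ¬ Wait G f a (c.loc a) (c.loc a).phase

lemma live_init : Live G f pEnd (Config.init input) := by
  refine ⟨fun a m hm => hm.elim, fun a m hm => hm.elim, fun a p h1 h2 => ?_,
    fun a y hm => hm.elim⟩
  have : p ≤ 0 := h2
  omega

lemma Live.step {c c' : Config V} {e : Event V} (hl : Live G f pEnd c)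
    (hs : Safe G f pEnd mode input c) (h : Step G f pEnd mode c e c') : Live G f pEnd c' := by
  have hav : ∀ {a b m}, c.Available a b m → c'.Available a b m := h.available_mono
  have hkeep (hloc : c'.loc = c.loc) : Live G f pEnd c' := by
    constructor <;> rw [hloc]
    · exact hl.got
    · exact fun a m hm b hb => hav (hl.relay a m hm b hb)
    · exact fun a p h1 h2 h3 => (hl.own a p h1 h2 h3).imp fun y hy b hb => hav (hy b hb)
    · exact hl.wait
  rcases h.outcome with ⟨hloc, -⟩ |
    ⟨i, A, s, ms, hi, -, hA, ho, -, ⟨-, hloc, -⟩ | ⟨hloc, hne, -, hb⟩⟩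
  · exact hkeep hloc
  · exact hkeep hloc
  have hsend : ∀ m ∈ ms, ∀ b ∈ outNbrs G i, c'.Available i b m :=
    fun m hm b hb' => .inl (hb _ (mem_broadcast.2 ⟨rfl, hb', hm⟩))
  refine ⟨fun a m hm => ?_, fun a m hm b hb' => ?_, fun a p h1 h2 h3 => ?_, fun a y hm => ?_⟩
  · by_cases hai : a = i
    · subst hai
      rw [hloc] at hm ⊢
      by_cases hm' : m ∈ (c.loc a).received
      · exact ho.got_mono _ (hl.got a m hm')
      · exact ho.got_new m (((ho.mem_received m).1 hm).resolve_left hm') hm'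
    · rw [hne a hai] at hm ⊢
      exact hl.got a m hm
  · by_cases hai : a = i
    · subst hai
      rw [hloc] at hm
      by_cases hm' : m ∈ (c.loc a).received
      · exact hav (hl.relay a m hm' b hb')
      · exact hsend m (ho.sent m (((ho.mem_received m).1 hm).resolve_left hm') hm') b hb'
    · rw [hne a hai] at hm
      exact hav (hl.relay a m hm b hb')
  · by_cases hp : p ≤ (c.loc a).phase
    · exact (hl.own a p h1 hp h3).imp fun y hy b hb => hav (hy b hb)
    · by_cases hai : a = i
      · subst hai
        rw [hloc] at h2
        rcases ho.core with ⟨hcore, -⟩ | ⟨v, hph, -, -, -, hms, -⟩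
        · exact absurd (hcore.1 ▸ h2) hp
        · obtain rfl : p = (c.loc a).phase + 1 := by omega
          exact ⟨v, hsend _ (hms h3)⟩
      · rw [hne a hai] at h2
        exact absurd h2 hp
  · by_cases hai : a = i
    · subst hai
      rw [hloc] at hm ⊢
      rcases ho.core with ⟨hcore, -, -, rfl | ⟨m, hmA, rfl, hnw⟩⟩ | ⟨v, hph, -⟩
      · exact hl.wait a y hm
      · by_cases hmp : m.phase = (c.loc a).phase
        · exact fun hw => hnw ⟨hmp, hw⟩
        · have hm' : ⟨y, a, (c.loc a).phase⟩ ∈ (c.loc a).received := by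
            rcases Set.mem_insert_iff.1 hm with heq | hm
            · exact absurd (congrArg Msg.phase heq).symm hmp
            · exact hm
          refine fun hw => hl.wait a y hm' (hw.of_got_subset fun x hx => ?_)
          rcases LocalState.mem_store_got.1 hx with hx | ⟨hx, -⟩
          · exact hx
          · exact absurd hx.symm hmp
      -- On entering a phase the claim is vacuous: the node's own message of that phase did not
      -- exist before this step.
      · have hk : ⟨y, a, s.phase⟩ ∈ c.known := by
          rcases (ho.mem_received _).1 hm with hm | hm
          · exact .inr ⟨a, .inl hm⟩
          · exact hA hm
        have := hs.fresh _ hk hi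
        simp only at this
        omega
    · rw [hne a hai] at hm ⊢
      exact hl.wait a y hm

end Invariants

/-! ### Executions -/

namespace Execution

variable [Fintype V] {G : Digraph V} {f pEnd : ℕ} {mode : Averaging} {input : V → ℝ}

lemma safe (E : Execution G f pEnd mode input) (t : ℕ) : Safe G f pEnd mode input (E.cfg t) := by
  induction t with
  | zero => rw [E.init]; exact safe_init
  | succ t ih => exact ih.step (E.step t)

lemma live (E : Execution G f pEnd mode input) (t : ℕ) : Live G f pEnd (E.cfg t) := by
  induction t with
  | zero => rw [E.init]; exact live_init
  | succ t ih => exact ih.step (E.safe t) (E.step t)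

lemma known_mono (E : Execution G f pEnd mode input) : Monotone fun t => (E.cfg t).known :=
  monotone_nat_of_le_succ fun t => (E.step t).known_mono

lemma received_mono (E : Execution G f pEnd mode input) (a : V) :
    Monotone fun t => ((E.cfg t).loc a).received :=
  monotone_nat_of_le_succ fun t => (E.step t).received_mono a

lemma phase_mono (E : Execution G f pEnd mode input) (a : V) :
    Monotone fun t => ((E.cfg t).loc a).phase :=
  monotone_nat_of_le_succ fun t => (E.step t).phase_mono a

/-! ### Validity and agreement. -/

lemma Outputs.attainable {E : Execution G f pEnd mode input} {i : V} {y : ℝ}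
    (h : E.Outputs i y) : ∃ t, Attainable G f mode input (E.cfg t).known pEnd y := by
  obtain ⟨t, ht⟩ := h
  obtain ⟨hp, rfl⟩ := ((E.safe t).out_iff i y).1 ht
  have := (E.safe t).attainable_val i
  rw [hp] at this
  exact ⟨t, this⟩

theorem validity (E : Execution G f pEnd mode input) : E.Validity := by
  intro i _ y hy
  obtain ⟨t, ht⟩ := hy.attainable
  exact ht.mem_convexHull (E.safe t).attainable

lemma Outputs.abs_sub_le {E : Execution G f pEnd mode input} (hG : PropagationCondition G f)
    {a b : ℝ} (hin : ∀ i, input i ∈ Set.Icc a b) {i j : V} {y z : ℝ}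
    (hy : E.Outputs i y) (hz : E.Outputs j z) :
    |y - z| ≤ (b - a) * (1 - 1 / ((Fintype.card V : ℝ) + 1) ^ 2) ^ pEnd := by
  obtain ⟨t, ht⟩ := hy.attainable
  obtain ⟨t', ht'⟩ := hz.attainable
  -- The outputs may appear at different times; both are attainable from the messages known at the
  -- later one.
  have hs := E.safe (max t t')
  exact (ht.mono (E.known_mono (le_max_left t t'))).abs_sub_le hG hs.attainable hs.unique hin
    (ht'.mono (E.known_mono (le_max_right t t')))

/-! ### Termination. -/

lemma eventually_received {E : Execution G f pEnd mode input} (hE : E.Fair) {a b : V} {m : Msg V}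
    {t : ℕ} (hb : b ∉ E.faulty) (h : (E.cfg t).Available a b m) :
    ∃ t', m ∈ ((E.cfg t').loc b).received := by
  rcases h with h | h
  · obtain ⟨t', -, ht'⟩ := hE.2 t _ h hb
    refine ⟨t' + 1, ?_⟩
    have hstep := E.step t'
    rw [ht'] at hstep
    generalize E.cfg (t' + 1) = c' at hstep
    cases hstep with
    | deliver _ rest s ms alive started mem eq =>
      have ho := outcome_receive G f pEnd mode b m ((E.cfg t').loc b)
      rw [eq] at ho
      simpa using (ho.mem_received m).2 (.inr rfl)
  · exact ⟨t, h⟩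

/-- Each link of the path ends outside `F`, at a fault-free node, which therefore receives the
relayed message and relays it in turn. -/
lemma received_of_path {E : Execution G f pEnd mode input} (hE : E.Fair) {F : Finset V}
    (hF : (F : Set V) = E.faulty) {a b : V} (h : Relation.ReflTransGen (reduced G F).Adj a b)
    {m : Msg V} {t : ℕ} (hm : m ∈ ((E.cfg t).loc a).received) :
    ∃ t', m ∈ ((E.cfg t').loc b).received := by
  induction h with
  | refl => exact ⟨t, hm⟩
  | @tail b d _ hbd ih =>
    obtain ⟨t', ht'⟩ := ih
    refine eventually_received hE (a := b) (t := t') (hF ▸ fun h => hbd.2.2 h)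
      ((E.live t').relay b m ht' d ?_)
    simp [outNbrs, hbd.1]

/-- Induction on the phase, for all fault-free nodes at once; `p = pEnd` gives phase `pEnd + 1`,
where a node outputs. -/
lemma eventually_phase {E : Execution G f pEnd mode input} (hf : E.faulty.ncard ≤ f)
    (hE : E.Fair) (p : ℕ) (hp : p ≤ pEnd) {i : V} (hi : i ∉ E.faulty) :
    ∃ t, p + 1 ≤ ((E.cfg t).loc i).phase := by
  classical
  induction p generalizing i with
  | zero =>
    obtain ⟨t, ht⟩ := hE.1 i hi
    refine ⟨t + 1, ?_⟩
    have hstep := E.step t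
    rw [ht] at hstep
    generalize E.cfg (t + 1) = c' at hstep
    cases hstep with
    | start _ s ms alive fresh eq =>
      have := enter_phase pEnd i 1 ((E.cfg t).loc i)
      rw [eq] at this
      simp [show s.phase = 1 from this]
  | succ p ih =>
    by_contra! hcon
    set F : Finset V := E.faulty.toFinset with hFdef
    have hF : (F : Set V) = E.faulty := by simp [hFdef]
    have hmem : ∀ j, j ∈ F ↔ j ∈ E.faulty := fun j => by simp [hFdef]
    have hev : ∀ j ∈ reach G F i, ∃ y t, ⟨y, j, p + 1⟩ ∈ ((E.cfg t).loc i).received := by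
      rintro j ⟨hjF, hpath⟩
      have hj : j ∉ E.faulty := fun h => hjF ((hmem j).2 h)
      obtain ⟨t, ht⟩ := ih (by omega) hj
      obtain ⟨y, hy⟩ := (E.live t).own j (p + 1) (by omega) ht hp
      obtain ⟨t', ht'⟩ := eventually_received hE hj (hy j (by simp [outNbrs]))
      exact ⟨y, received_of_path hE hF hpath ht'⟩
    choose! y τ hτ using hev
    obtain ⟨t₀, ht₀⟩ := ih (by omega) hi
    -- By time `T`, node `i` is in phase `p + 1` and has received that phase's message of every node
    -- that reaches it.
    set T := max t₀ (Finset.univ.sup τ) with hT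
    have hrec : ∀ j ∈ reach G F i, ⟨y j, j, p + 1⟩ ∈ ((E.cfg T).loc i).received := fun j hj =>
      E.received_mono i ((Finset.le_sup (Finset.mem_univ j)).trans (le_max_right _ _)) (hτ j hj)
    have hphase : ((E.cfg T).loc i).phase = p + 1 := by
      have h1 := hcon T
      have h2 : _ ≤ _ := E.phase_mono i (le_max_left t₀ (Finset.univ.sup τ))
      simp only [← hT] at h2
      omega
    have hiF : i ∉ F := fun h => hi ((hmem i).1 h)
    refine (E.live T).wait i (y i) (hphase ▸ hrec i (mem_reach_self hiF)) ?_
    rw [hphase]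
    refine ⟨F, hiF, ?_, fun j hj => ⟨y j, (E.live T).got i _ (hrec j hj)⟩⟩
    rwa [← Set.ncard_coe_finset, hF]

theorem termination {E : Execution G f pEnd mode input} (hf : E.faulty.ncard ≤ f)
    (hE : E.Fair) : E.Termination := by
  intro i hi
  obtain ⟨t, ht⟩ := eventually_phase hf hE pEnd le_rfl hi
  exact ⟨_, t, ((E.safe t).out_iff i _).2 ⟨((E.safe t).phase_le i).antisymm ht, rfl⟩⟩

end Execution

end WaitAverage

theorem theorem6 (n f : ℕ) (m M ε : ℝ) (hε : 0 < ε) :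
    ∃ P : ℕ, ∀ pEnd : ℕ, P ≤ pEnd →
      ∀ (V : Type u) [Fintype V], Fintype.card V = n →
      ∀ G : Digraph V, WaitAverage.PropagationCondition G f →
      ∀ (mode : WaitAverage.Averaging) (input : V → ℝ), (∀ i, input i ∈ Set.Icc m M) →
      ∀ E : WaitAverage.Execution G f pEnd mode input, E.faulty.ncard ≤ f → E.Fair →
        E.Agreement ε ∧ E.Validity ∧ E.Termination := by
  have hq : 1 / ((n : ℝ) + 1) ^ 2 ≤ 1 :=
    div_le_one_of_le₀ (one_le_pow₀ (by linarith [n.cast_nonneg (α := ℝ)])) (by positivity)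
  have hq' : 0 < 1 / ((n : ℝ) + 1) ^ 2 := by positivity
  -- The contraction factor involves only `n`, so one `P` serves all graphs, inputs and executions.
  have hlim := (tendsto_pow_atTop_nhds_zero_of_lt_one (r := 1 - 1 / ((n : ℝ) + 1) ^ 2)
    (by linarith) (by linarith)).const_mul (M - m)
  rw [mul_zero] at hlim
  obtain ⟨P, hP⟩ := Filter.eventually_atTop.1 (hlim.eventually_le_const hε)
  refine ⟨P, fun pEnd hpEnd V _ hV G hG mode input hin E hf hE =>
    ⟨fun i j _ _ y z hy hz => ?_, E.validity, E.termination hf hE⟩⟩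
  have := hy.abs_sub_le hG hin hz
  rw [hV] at this
  exact this.trans (hP pEnd hpEnd)
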